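/- **Model.** A network is a finite connected undirected graph $G=(\Pi,E)$ with $n$ processes and maximum degree $\Delta$; $\Gamma.p$ is the set of neighbours of $p$ and $\delta.p=|\Gamma.p|$, and each $p$ numbers its neighbours $1,\dots,\delta.p$ in an arbitrary way. The network is locally identified: each process $p$ has a constant colour $C.p$ in a set totally ordered by $\prec$, and neighbours have different colours. In a step, a nonempty set of processes is selected; simultaneously, each selected process executes, atomically, its enabled action of highest priority, if any. A computation is an infinite sequence of steps, starting from an arbitrary configuration, in which every process is selected infinitely often. The first round of a computation is its minimal prefix in which every process has been selected, the second round is the first round of the remaining suffix, and so on. A protocol is $k$-efficient if in every step of every computation every process reads the communication variables of at most $k$ neighbours. It self-stabilizes to a predicate $R$ on configurations if $R$ is closed (every computation that starts in $R$ stays in $R$) and every computation reaches $R$. A configuration is silent if in every computation that starts from it all communication variables stay fixed. **Protocol MATCHING.** Each $p$ has communication variables $M.p\in\{true,false\}$ and $PR.p\in\{0\}\cup\Gamma.p$, the communication constant $C.p$, and the internal variable $cur.p\in\Gamma.p$. Let $PRmarried(p)\equiv(PR.p=cur.p\wedge PR.(cur.p)=p)$. The actions, from highest to lowest priority, are: 1.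 $PR.p\notin\{0,cur.p\}\to PR.p\gets cur.p$; 2. $M.p\ne PRmarried(p)\to M.p\gets PRmarried(p)$; 3. $PR.p=0\wedge PR.(cur.p)=p\to PR.p\gets cur.p$; 4. $PR.p=cur.p\wedge PR.(cur.p)\ne p\wedge(M.(cur.p)\vee C.(cur.p)\prec C.p)\to PR.p\gets 0$; 5. $PR.p=0\wedge PR.(cur.p)=0\wedge C.p\prec C.(cur.p)\wedge\neg M.(cur.p)\to PR.p\gets cur.p$; 6. $PR.p=0\wedge(PR.(cur.p)\ne0\vee C.(cur.p)\prec C.p\vee M.(cur.p))\to cur.p\gets$ the next neighbour of $p$ in the cyclic order of its numbering. For neighbours $p,q$ let $inMM[q].p\equiv(PRmarried(p)\wedge PR.p=q)$. In a configuration, let $A_\vee$ be the set of edges $\{p,q\}$ with $inMM[q].p\vee inMM[p].q$, and $A_\wedge$ the set of edges $\{p,q\}$ with $inMM[q].p\wedge inMM[p].q$. A process is married if it and some neighbour point at each other with their $PR$-variables, and unmarried otherwise. **Theorem.** In any locally-identified network: - MATCHING is $1$-efficient. - MATCHING self-stabilizes to the predicate "$A_\wedge$ is a maximal matching of $G$".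 - In every silent configuration $A_\vee=A_\wedge$, and this set is a maximal matching of $G$. - Every computation, from any initial configuration, reaches a silent configuration within $(\Delta+1)n+2$ rounds. - In every configuration after the first round of any computation, $A_\vee=A_\wedge$. - If $A$ is a maximal connected set of unmarried processes in some configuration after the first round and $|A|\ge2$, then after at most $2\Delta+2$ further rounds, and from then on, at least two processes of $A$ are married. -/

import Mathlib

universe u v w a b

namespace SelfStab

variable {V : Type u}

/-! ## Programs that read the communication state of neighbours -/

/-- A program run by the process `p` in one atomic step.  The only way to learn something about
another process is the instruction `read q next`, which reads the communication state (constants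
and variables) of the neighbour `q`; `Obs q` is the type of the communication states of `q`. -/
inductive Prog (G : SimpleGraph V) (Obs : V → Type w) (p : V) (α : Type a) : Type (max u w a)
  | ret (a : α) : Prog G Obs p α
  | read (q : G.neighborSet p) (next : Obs q → Prog G Obs p α) : Prog G Obs p α

namespace Prog

variable {G : SimpleGraph V} {Obs : V → Type w} {p : V} {α : Type a} {β : Type b}

/-- Sequential composition. -/
def bind : Prog G Obs p α → (α → Prog G Obs p β) → Prog G Obs p β
  | ret a, f => f a
  | read q next, f => read q fun o => (next o).bind f

/-- The result of a program when the communication states are given by `obs`. -/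
def eval (obs : ∀ q, Obs q) : Prog G Obs p α → α
  | ret a => a
  | read q next => (next (obs q)).eval obs

/-- The set of neighbours that are read when the program is run. -/
def reads (obs : ∀ q, Obs q) : Prog G Obs p α → Set V
  | ret _ => ∅
  | read q next => insert (q : V) ((next (obs q)).reads obs)

end Prog

/-! ## Protocols -/

/-- A guarded action of the process `p` with state space `S`.  Guard and action may use the state
of `p`, and the communication states of neighbours by reading them. -/
structure GuardedAction (G : SimpleGraph V) (Obs : V → Type w) (p : V) (S : Type a) where
  guard : S → Prog G Obs p Prop
  action : S → Prog G Obs p S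

/-- A protocol on the network `G`.  The process `p` has communication constants `const p`,
communication variables with values in `Comm p`, internal variables with values in `Intern p`, and
a list of guarded actions, in order of decreasing priority. -/
structure Protocol (G : SimpleGraph V) where
  Const : Type v
  const : V → Const
  Comm : V → Type u
  Intern : V → Type u
  actions : ∀ p, List (GuardedAction G (fun q => Const × Comm q) p (Comm p × Intern p))

namespace Protocol

variable {G : SimpleGraph V} (P : Protocol.{u, v} G)

/-- The communication states of the process `q`: constants and variables. -/
abbrev Obs (q : V) : Type (max u v) := P.Const × P.Comm q

/-- The states of the process `p`. -/
abbrev State (p : V) : Type u := P.Comm p × P.Intern p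

/-- A configuration: the states of all processes. -/
abbrev Config : Type u := ∀ p, P.State p

/-- The communication configuration of a configuration. -/
def obs (γ : P.Config) : ∀ q, P.Obs q := fun q => (P.const q, (γ q).1)

open Classical in
/-- Evaluate the guards one after the other, in order of priority, and execute the action of the
first guard that holds; do nothing if all guards are false. -/
noncomputable def runList {p : V} (s : P.State p) :
    List (GuardedAction G P.Obs p (P.State p)) → Prog G P.Obs p (P.State p)
  | [] => .ret s
  | a :: l => (a.guard s).bind fun b => if b then a.action s else runList s l

/-- The program run by `p` when it is activated in state `s`. -/
noncomputable def prog (p : V) (s : P.State p) : Prog G P.Obs p (P.State p) :=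
  P.runList s (P.actions p)

/-- The state of `p` after an activation of `p` in the configuration `γ`. -/
noncomputable def exec (γ : P.Config) (p : V) : P.State p :=
  (P.prog p (γ p)).eval (P.obs γ)

/-- A computation under the distributed fair scheduler: in step `i` the processes of the nonempty
set `sel i` simultaneously execute, from `conf i`, their enabled action of highest priority, if
any; every process is selected infinitely often. -/
structure Computation where
  conf : ℕ → P.Config
  sel : ℕ → Set V
  sel_nonempty : ∀ i, (sel i).Nonempty
  step_sel : ∀ i, ∀ p ∈ sel i, conf (i + 1) p = P.exec (conf i) p
  step_not_sel : ∀ i, ∀ p ∉ sel i, conf (i + 1) p = conf i p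
  fair : ∀ p, ∀ N, ∃ i, N ≤ i ∧ p ∈ sel i

variable {P} in
/-- The index of the configuration that ends the `k`-th round of the suffix starting at index `i`.
A round is the minimal sequence of consecutive steps in which every process is selected.  (By
fairness, the infimum is over a nonempty set when there are finitely many processes.) -/
noncomputable def Computation.roundEnd (e : P.Computation) (i : ℕ) : ℕ → ℕ
  | 0 => i
  | k + 1 => sInf {j | ∀ p, ∃ t, e.roundEnd i k ≤ t ∧ t < j ∧ p ∈ e.sel t}

variable {P} in
/-- The set of neighbours from which `p` reads communication variables in step `i`. -/
def Computation.readSet (e : P.Computation) (i : ℕ) (p : V) : Set V :=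
  {q | p ∈ e.sel i ∧ q ∈ (P.prog p (e.conf i p)).reads (P.obs (e.conf i))}

/-- In every step of every computation, every process reads communication variables of at most
`k` neighbours. -/
def KEfficient (k : ℕ) : Prop :=
  ∀ (e : P.Computation) (i : ℕ) (p : V), (e.readSet i p).encard ≤ k

/-- Closed predicates on configurations. -/
def IsClosedPred (R : P.Config → Prop) : Prop :=
  ∀ e : P.Computation, R (e.conf 0) → ∀ i, R (e.conf i)

/-- The predicate `R` converges to the predicate `S`. -/
def ConvergesTo (R S : P.Config → Prop) : Prop :=
  P.IsClosedPred R ∧ P.IsClosedPred S ∧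
    ∀ e : P.Computation, R (e.conf 0) → ∃ i, S (e.conf i)

/-- The protocol (deterministically) self-stabilizes to the predicate `R`. -/
def Stabilizes (R : P.Config → Prop) : Prop :=
  P.ConvergesTo (fun _ => True) R

/-- A configuration from which the values of all communication variables are fixed. -/
def Silent (γ : P.Config) : Prop :=
  ∀ e : P.Computation, e.conf 0 = γ → ∀ i p, (e.conf i p).1 = (γ p).1

end Protocol

/-! ## Matchings -/

/-- A matching: a set of edges no two of which have a common endpoint. -/
def IsMatching (G : SimpleGraph V) (M : Set (Sym2 V)) : Prop :=
  M ⊆ G.edgeSet ∧ ∀ e ∈ M, ∀ f ∈ M, e ≠ f → ∀ x, ¬ (x ∈ e ∧ x ∈ f)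

/-- A maximal matching: a matching no proper superset of which is a matching. -/
def IsMaximalMatching (G : SimpleGraph V) (M : Set (Sym2 V)) : Prop :=
  Maximal (IsMatching G) M

/-! ## The protocol MATCHING -/

/-- The communication variables of `p`: the Boolean `M` and the pointer `PR`, which is `0` (here
`none`) or a neighbour of `p`. -/
structure MComm (G : SimpleGraph V) (p : V) where
  M : Bool
  PR : Option (G.neighborSet p)

/-- The pointer value `x` of the process `q` designates the process `p`. -/
def PointsTo {G : SimpleGraph V} {q : V} (x : Option (G.neighborSet q)) (p : V) : Prop :=
  ∃ r, x = some r ∧ (r : V) = p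

section Matching

variable [Fintype V] (G : SimpleGraph V) [DecidableRel G.Adj]

/-- The update `cur.p ← (cur.p mod δ.p) + 1`, where `idx p` numbers the neighbours of `p` (from `0`
to `δ.p - 1`). -/
def nextNbr (idx : ∀ p, G.neighborSet p ≃ Fin (G.degree p)) (p : V) (c : G.neighborSet p) :
    G.neighborSet p :=
  (idx p).symm ⟨((idx p c : ℕ) + 1) % G.degree p, Nat.mod_lt _ (idx p c).pos⟩

/-- What `p` reads from a neighbour `q`: the constant `C.q` and the variables `M.q`, `PR.q`. -/
abbrev MObs (K : Type v) (q : V) : Type (max u v) := K × MComm G q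

/-- The states of `p` in MATCHING: the communication variables `M.p`, `PR.p` and the internal
variable `cur.p`, a neighbour of `p`. -/
abbrev MState (p : V) : Type u := MComm G p × G.neighborSet p

/-- `PRmarried(p)`, for `p` in state `s` and with `o` the communication state of `cur.p`. -/
def PRmarried {G : SimpleGraph V} {K : Type v} {p : V} (s : MState G p) (o : MObs G K s.2) : Prop :=
  s.1.PR = some s.2 ∧ PointsTo o.2.PR p

open Classical in
/-- The six guarded actions of the process `p`. -/
noncomputable def matchingActions {K : Type v} [LinearOrder K] (C : V → K)
    (idx : ∀ p, G.neighborSet p ≃ Fin (G.degree p)) (p : V) :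
    List (GuardedAction G (MObs G K) p (MState G p)) :=
  [ { guard := fun s => .ret (¬ (s.1.PR = none ∨ s.1.PR = some s.2))
      action := fun s => .ret (⟨s.1.M, some s.2⟩, s.2) },
    { guard := fun s => .read s.2 fun o => .ret (s.1.M ≠ decide (PRmarried s o))
      action := fun s => .read s.2 fun o => .ret (⟨decide (PRmarried s o), s.1.PR⟩, s.2) },
    { guard := fun s => .read s.2 fun o => .ret (s.1.PR = none ∧ PointsTo o.2.PR p)
      action := fun s => .ret (⟨s.1.M, some s.2⟩, s.2) },
    { guard := fun s => .read s.2 fun o => .ret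
        (s.1.PR = some s.2 ∧ ¬ PointsTo o.2.PR p ∧ (o.2.M = true ∨ o.1 < C p))
      action := fun s => .ret (⟨s.1.M, none⟩, s.2) },
    { guard := fun s => .read s.2 fun o => .ret
        (s.1.PR = none ∧ o.2.PR = none ∧ C p < o.1 ∧ ¬ o.2.M = true)
      action := fun s => .ret (⟨s.1.M, some s.2⟩, s.2) },
    { guard := fun s => .read s.2 fun o => .ret
        (s.1.PR = none ∧ (o.2.PR ≠ none ∨ o.1 < C p ∨ o.2.M = true))
      action := fun s => .ret (s.1, nextNbr G idx p s.2) } ]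

/-- Protocol MATCHING on the network `G` with colors `C` and local indices `idx`. -/
noncomputable def matchingProtocol {K : Type v} [LinearOrder K] (C : V → K)
    (idx : ∀ p, G.neighborSet p ≃ Fin (G.degree p)) : Protocol.{u, v} G where
  Const := K
  const := C
  Comm := MComm G
  Intern := fun p => G.neighborSet p
  actions := matchingActions G C idx

end Matching

section Predicates

variable {G : SimpleGraph V}

/-- `inMM[q].p`, that is, `PRmarried(p) ∧ PR.p = q`, in the configuration `γ`. -/
def InMM (γ : ∀ p, MState G p) (p q : V) : Prop :=
  ((γ p).1.PR = some (γ p).2 ∧ PointsTo (γ (γ p).2).1.PR p) ∧ PointsTo (γ p).1.PR q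

/-- The edges `{p, q}` with `inMM[q].p ∨ inMM[p].q`. -/
def outputEdges (γ : ∀ p, MState G p) : Set (Sym2 V) :=
  {e | ∃ p q, G.Adj p q ∧ e = s(p, q) ∧ (InMM γ p q ∨ InMM γ q p)}

/-- The edges `{p, q}` on which both endpoints agree: `inMM[q].p ∧ inMM[p].q`. -/
def agreedEdges (γ : ∀ p, MState G p) : Set (Sym2 V) :=
  {e | ∃ p q, G.Adj p q ∧ e = s(p, q) ∧ (InMM γ p q ∧ InMM γ q p)}

/-- `p` is married: `p` and some neighbour point at each other. -/
def Married (γ : ∀ p, MState G p) (p : V) : Prop :=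
  ∃ q, PointsTo (γ p).1.PR q ∧ PointsTo (γ q).1.PR p

/-- `A` is a maximal connected set of unmarried processes. -/
def IsUnmarriedComponent (γ : ∀ p, MState G p) (A : Set V) : Prop :=
  Maximal (fun S : Set V => (∀ p ∈ S, ¬ Married γ p) ∧ (G.induce S).Connected) A

end Predicates

end SelfStab

/-! A process reads only the neighbour in its variable `cur`, which gives 1-efficiency. Its first
activation makes a process `Aligned` for good, so after one round being married is the same as
seeing oneself married (`Aligned.wed_iff`), and an edge claimed by one endpoint is claimed by both.
Processes that point at each other never let go (`partner_of_le`); one round later `M` is true on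
the married processes and false on those still unmarried.

Progress is `exists_married_of_adj`. Let `A` contain an edge and have only married neighbours
outside it, and suppose that no member is married at the end of `2Δ+2` rounds. After one round `M`
is false on `A` and true on its outside neighbours. After two, every nonzero pointer in `A` leads to
a member of larger colour and is never withdrawn. In the next `Δ` rounds a process with pointer 0
examines all its neighbours, and it would propose to a larger member with pointer 0; so not all
pointers in `A` are 0. Among the members with nonzero pointer let `p` have the largest colour. Its
target `q` has pointer 0 and finds nobody to propose to, so within `Δ` more rounds it examines `p`
and accepts, a contradiction.

The spouse of a newly married member is also in `A`, so each block of `2Δ+2` rounds marries two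
processes until no edge joins unmarried ones. One or two more rounds settle `M` and the pointers
(`settled_of_married`, `settled_of_maximal`). The claims on silent configurations follow by running
the synchronous computation from them. -/

namespace SelfStab

/-! ### Evaluation and read sets of programs -/

section Evaluation

variable {V : Type u} {G : SimpleGraph V}

theorem Prog.eval_bind {Obs : V → Type*} {p : V} {α β : Type*} (obs : ∀ q, Obs q)
    (x : Prog G Obs p α) (f : α → Prog G Obs p β) :
    (x.bind f).eval obs = (f (x.eval obs)).eval obs := by
  induction x with
  | ret a => rfl
  | read q next ih => exact ih _

theorem Prog.reads_bind {Obs : V → Type*} {p : V} {α β : Type*} (obs : ∀ q, Obs q)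
    (x : Prog G Obs p α) (f : α → Prog G Obs p β) :
    (x.bind f).reads obs = x.reads obs ∪ (f (x.eval obs)).reads obs := by
  induction x with
  | ret a => simp [Prog.bind, Prog.reads, Prog.eval]
  | read q next ih => simp [Prog.bind, Prog.reads, Prog.eval, ih, Set.insert_union]

theorem Protocol.eval_runList_cons (P : Protocol.{u, v} G) {p : V} (obs : ∀ q, P.Obs q)
    (s : P.State p) (a : GuardedAction G P.Obs p (P.State p))
    (l : List (GuardedAction G P.Obs p (P.State p))) {x : P.State p}
    (hx : x = (P.runList s (a :: l)).eval obs) :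
    (a.guard s).eval obs ∧ x = (a.action s).eval obs ∨
      ¬ (a.guard s).eval obs ∧ x = (P.runList s l).eval obs := by
  rw [Protocol.runList, Prog.eval_bind] at hx
  split_ifs at hx with h
  · exact .inl ⟨h, hx⟩
  · exact .inr ⟨h, hx⟩

theorem Protocol.reads_runList_subset (P : Protocol.{u, v} G) {p : V} (obs : ∀ q, P.Obs q)
    (s : P.State p) (R : Set V) (l : List (GuardedAction G P.Obs p (P.State p)))
    (h : ∀ a ∈ l, (a.guard s).reads obs ⊆ R ∧ (a.action s).reads obs ⊆ R) :
    (P.runList s l).reads obs ⊆ R := by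
  induction l with
  | nil => exact Set.empty_subset _
  | cons a l ih =>
    rw [Protocol.runList, Prog.reads_bind]
    refine Set.union_subset (h a List.mem_cons_self).1 ?_
    split_ifs
    · exact (h a List.mem_cons_self).2
    · exact ih fun b hb => h b (List.mem_cons_of_mem _ hb)

end Evaluation

/-! ### Pointers, marriages and the matching of agreed edges -/

section Pointers

variable {V : Type u} {G : SimpleGraph V}

/-- The pointer of `p` as an optional process. -/
def ptr (γ : ∀ p, MState G p) (p : V) : Option V := (γ p).1.PR.map Subtype.val

/-- The neighbour that `p` currently examines. -/
def cur (γ : ∀ p, MState G p) (p : V) : V := (γ p).2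

/-- The process `p` and the neighbour that it examines point at each other. -/
def Wed (γ : ∀ p, MState G p) (p : V) : Prop :=
  ptr γ p = some (cur γ p) ∧ ptr γ (cur γ p) = some p

/-- The pointer of `p` is `0` or the neighbour that `p` examines. -/
def Aligned (γ : ∀ p, MState G p) (p : V) : Prop :=
  ptr γ p = none ∨ ptr γ p = some (cur γ p)

theorem adj_cur (γ : ∀ p, MState G p) (p : V) : G.Adj p (cur γ p) := (γ p).2.2

theorem cur_congr {γ γ' : ∀ p, MState G p} {p : V} (h : (γ' p).2 = (γ p).2) :
    cur γ' p = cur γ p := by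
  rw [cur, h, cur]

theorem ptr_congr {γ γ' : ∀ p, MState G p} {p : V} (h : γ' p = γ p) : ptr γ' p = ptr γ p := by
  rw [ptr, h, ptr]

theorem Aligned.congr {γ γ' : ∀ p, MState G p} {p : V} (hal : Aligned γ p) (h : γ' p = γ p) :
    Aligned γ' p := by
  unfold Aligned at *
  rwa [ptr_congr h, cur_congr (congrArg Prod.snd h)]

theorem pointsTo_iff (γ : ∀ p, MState G p) (p q : V) :
    PointsTo (γ p).1.PR q ↔ ptr γ p = some q := by
  simp only [PointsTo, ptr, Option.map_eq_some_iff]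

theorem married_iff (γ : ∀ p, MState G p) (p : V) :
    Married γ p ↔ ∃ q, ptr γ p = some q ∧ ptr γ q = some p := by
  simp [Married, pointsTo_iff]

theorem PR_eq_some_iff (γ : ∀ p, MState G p) (p : V) :
    (γ p).1.PR = some (γ p).2 ↔ ptr γ p = some (cur γ p) := by
  simp only [ptr, cur]
  cases (γ p).1.PR <;> simp [Subtype.ext_iff]

theorem PR_eq_none_iff (γ : ∀ p, MState G p) (p : V) :
    (γ p).1.PR = none ↔ ptr γ p = none := by
  simp [ptr]

theorem comm_ext {γ γ' : ∀ p, MState G p} {p : V} (hM : (γ' p).1.M = true ↔ (γ p).1.M = true)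
    (hp : ptr γ' p = ptr γ p) : (γ' p).1 = (γ p).1 := by
  have h1 : (γ' p).1.M = (γ p).1.M := Bool.eq_iff_iff.2 hM
  have h2 : (γ' p).1.PR = (γ p).1.PR := Option.map_injective Subtype.val_injective hp
  generalize (γ' p).1 = a at *
  generalize (γ p).1 = b at *
  cases a; cases b; simp_all

theorem inMM_iff (γ : ∀ p, MState G p) (p q : V) :
    InMM γ p q ↔ Wed γ p ∧ cur γ p = q := by
  rw [InMM, PR_eq_some_iff, pointsTo_iff, pointsTo_iff, Wed]
  change (_ ∧ ptr γ (cur γ p) = some p) ∧ _ ↔ _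
  constructor
  · rintro ⟨h, h'⟩
    exact ⟨h, by simpa [h.1] using h'⟩
  · rintro ⟨h, rfl⟩
    exact ⟨h, h.1⟩

theorem Wed.married {γ : ∀ p, MState G p} {p : V} (h : Wed γ p) : Married γ p :=
  (married_iff γ p).2 ⟨_, h⟩

theorem Aligned.wed {γ : ∀ p, MState G p} {p q : V} (h : Aligned γ p) (h1 : ptr γ p = some q)
    (h2 : ptr γ q = some p) : Wed γ p ∧ cur γ p = q := by
  rcases h with h | h
  · simp [h] at h1
  · obtain rfl : cur γ p = q := by simpa [h] using h1
    exact ⟨⟨h, h2⟩, rfl⟩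

theorem Aligned.wed_iff {γ : ∀ p, MState G p} {p : V} (h : Aligned γ p) :
    Wed γ p ↔ Married γ p := by
  refine ⟨Wed.married, fun hm => ?_⟩
  obtain ⟨q, h1, h2⟩ := (married_iff γ p).1 hm
  exact (h.wed h1 h2).1

theorem agreedEdges_subset_outputEdges (γ : ∀ p, MState G p) :
    agreedEdges γ ⊆ outputEdges γ := by
  rintro _ ⟨p, q, h, rfl, h1, -⟩
  exact ⟨p, q, h, rfl, Or.inl h1⟩

theorem mem_agreedEdges_of_inMM {γ : ∀ p, MState G p} {p q : V} (h : Aligned γ q)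
    (hpq : InMM γ p q) : s(p, q) ∈ agreedEdges γ := by
  obtain ⟨h1, rfl⟩ := (inMM_iff γ p q).1 hpq
  exact ⟨p, _, adj_cur γ p, rfl, hpq, (inMM_iff γ _ _).2 (h.wed h1.2 h1.1)⟩

theorem outputEdges_eq_agreedEdges {γ : ∀ p, MState G p} (h : ∀ p, Aligned γ p) :
    outputEdges γ = agreedEdges γ := by
  refine Set.Subset.antisymm ?_ (agreedEdges_subset_outputEdges γ)
  rintro _ ⟨p, q, -, rfl, h1 | h1⟩
  · exact mem_agreedEdges_of_inMM (h q) h1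
  · rw [Sym2.eq_swap]
    exact mem_agreedEdges_of_inMM (h p) h1

/-- An agreed edge joins each of its endpoints to the neighbour that the endpoint examines. -/
theorem eq_of_mem_agreedEdges {γ : ∀ p, MState G p} {f : Sym2 V} (hf : f ∈ agreedEdges γ) {x : V}
    (hx : x ∈ f) : f = s(x, cur γ x) := by
  obtain ⟨p, q, -, rfl, h1, h2⟩ := hf
  rw [inMM_iff] at h1 h2
  rcases Sym2.mem_iff.1 hx with rfl | rfl
  · rw [h1.2]
  · rw [h2.2, Sym2.eq_swap]

theorem isMatching_agreedEdges (γ : ∀ p, MState G p) : IsMatching G (agreedEdges γ) := by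
  refine ⟨?_, ?_⟩
  · rintro _ ⟨p, q, h, rfl, -⟩
    exact h
  · rintro f hf f' hf' hne x ⟨hx, hx'⟩
    exact hne ((eq_of_mem_agreedEdges hf hx).trans (eq_of_mem_agreedEdges hf' hx').symm)

/-- An edge of a larger matching has a married endpoint, whose marriage is an agreed edge by
alignment; both edges lie in the larger matching and share this endpoint, so they coincide. -/
theorem isMaximalMatching_agreedEdges {γ : ∀ p, MState G p} (h : ∀ p, Aligned γ p)
    (hadj : ∀ p q, G.Adj p q → Married γ p ∨ Married γ q) :
    IsMaximalMatching G (agreedEdges γ) := by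
  refine ⟨isMatching_agreedEdges γ, fun N hN hle f hf => ?_⟩
  have key : ∀ x ∈ f, Married γ x → f ∈ agreedEdges γ := by
    intro x hx hm
    have hw := (h x).wed_iff.2 hm
    have hmem := mem_agreedEdges_of_inMM (h (cur γ x)) ((inMM_iff γ x _).2 ⟨hw, rfl⟩)
    by_contra hcon
    refine hN.2 f hf _ (hle hmem) ?_ x ⟨hx, Sym2.mem_mk_left _ _⟩
    rintro rfl
    exact hcon hmem
  induction f with
  | _ p q =>
    rcases hadj p q (hN.1 hf) with hm | hm
    · exact key p (Sym2.mem_mk_left _ _) hm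
    · exact key q (Sym2.mem_mk_right _ _) hm

end Pointers

/-! ### Effect of a single activation -/

section Moves

variable {V : Type u} [Fintype V] {G : SimpleGraph V} [DecidableRel G.Adj] {K : Type v}
  [LinearOrder K]

/-- The possible effects on `p` of an activation of `p` that leads from `γ` to `γ'`. -/
inductive Move (C : V → K) (idx : ∀ p, G.neighborSet p ≃ Fin (G.degree p))
    (γ γ' : ∀ p, MState G p) (p : V) : Prop
  | align : ¬ Aligned γ p → ptr γ' p = some (cur γ p) → (γ' p).2 = (γ p).2 → Move C idx γ γ' p
  | mark : Aligned γ p → ¬ ((γ p).1.M = true ↔ Wed γ p) → ((γ' p).1.M = true ↔ Wed γ p) →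
      ptr γ' p = ptr γ p → (γ' p).2 = (γ p).2 → Move C idx γ γ' p
  | accept : ((γ p).1.M = true ↔ Wed γ p) → (γ' p).1.M = (γ p).1.M → ptr γ p = none →
      ptr γ (cur γ p) = some p → ptr γ' p = some (cur γ p) → (γ' p).2 = (γ p).2 →
      Move C idx γ γ' p
  | retract : ((γ p).1.M = true ↔ Wed γ p) → (γ' p).1.M = (γ p).1.M → ptr γ p = some (cur γ p) →
      ptr γ (cur γ p) ≠ some p → ((γ (cur γ p)).1.M = true ∨ C (cur γ p) < C p) →
      ptr γ' p = none → (γ' p).2 = (γ p).2 → Move C idx γ γ' p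
  | propose : ((γ p).1.M = true ↔ Wed γ p) → (γ' p).1.M = (γ p).1.M → ptr γ p = none →
      ptr γ (cur γ p) = none → C p < C (cur γ p) → ¬ (γ (cur γ p)).1.M = true →
      ptr γ' p = some (cur γ p) → (γ' p).2 = (γ p).2 → Move C idx γ γ' p
  | advance : ((γ p).1.M = true ↔ Wed γ p) → (γ' p).1.M = (γ p).1.M → ptr γ p = none →
      ptr γ (cur γ p) ≠ some p →
      (ptr γ (cur γ p) ≠ none ∨ C (cur γ p) < C p ∨ (γ (cur γ p)).1.M = true) →
      ptr γ' p = none → (γ' p).2 = nextNbr G idx p (γ p).2 → Move C idx γ γ' p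
  | idle : ((γ p).1.M = true ↔ Wed γ p) → ptr γ p = some (cur γ p) →
      (ptr γ (cur γ p) = some p ∨ ¬ (γ (cur γ p)).1.M = true ∧ ¬ C (cur γ p) < C p) →
      γ' p = γ p → Move C idx γ γ' p

-- Runs through the actions by priority. Each failed guard leaves a fact that the later constructors
-- of `Move` record.
open Classical in
theorem move_of_eq_exec {C : V → K} (hC : ∀ p q, G.Adj p q → C p ≠ C q)
    {idx : ∀ p, G.neighborSet p ≃ Fin (G.degree p)} {γ γ' : ∀ p, MState G p} {p : V}
    (h : γ' p = (matchingProtocol G C idx).exec γ p) : Move C idx γ γ' p := by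
  have hptr : ∀ x, γ' p = x → ptr γ' p = x.1.PR.map Subtype.val := fun x hx => by rw [ptr, hx]
  have hwed : PRmarried (γ p) (C (γ p).2, (γ (γ p).2).1) ↔ Wed γ p := by
    rw [PRmarried, PR_eq_some_iff, pointsTo_iff]; rfl
  have hsome := PR_eq_some_iff γ p
  have hnone := PR_eq_none_iff γ p
  have hnone' : (γ (γ p).2).1.PR = none ↔ ptr γ (cur γ p) = none := PR_eq_none_iff _ _
  have hto : PointsTo (γ (γ p).2).1.PR p ↔ ptr γ (cur γ p) = some p := pointsTo_iff _ _ _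
  replace h : γ' p = ((matchingProtocol G C idx).runList (γ p) (matchingActions G C idx p)).eval
    ((matchingProtocol G C idx).obs γ) := h
  rw [matchingActions] at h
  have step := @Protocol.eval_runList_cons _ _ (matchingProtocol G C idx) p
    ((matchingProtocol G C idx).obs γ) (γ p)
  rcases step _ _ h with ⟨h1, h⟩ | ⟨h1, h⟩
  · replace h : γ' p = (⟨(γ p).1.M, some (γ p).2⟩, (γ p).2) := h
    exact .align (not_congr (or_congr hnone hsome) |>.1 h1) (hptr _ h) (by rw [h])
  replace h1 : Aligned γ p := (or_congr hnone hsome).1 (not_not.1 h1)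
  rcases step _ _ h with ⟨h2, h⟩ | ⟨h2, h⟩
  · replace h : γ' p =
      (⟨decide (PRmarried (γ p) (C (γ p).2, (γ (γ p).2).1)), (γ p).1.PR⟩, (γ p).2) := h
    refine .mark h1 ?_ ?_ (by rw [ptr, h]; rfl) (by rw [h])
    · rw [← hwed]
      exact fun h3 => h2 (Bool.eq_iff_iff.2 (h3.trans decide_eq_true_iff.symm))
    · rw [← hwed, h]
      exact decide_eq_true_iff
  replace h2 : (γ p).1.M = decide (PRmarried (γ p) (C (γ p).2, (γ (γ p).2).1)) := not_not.1 h2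
  have hM : (γ p).1.M = true ↔ Wed γ p := by
    rw [← hwed]
    exact (Bool.eq_iff_iff.1 h2).trans decide_eq_true_iff
  rcases step _ _ h with ⟨h3, h⟩ | ⟨h3, h⟩
  · replace h : γ' p = (⟨(γ p).1.M, some (γ p).2⟩, (γ p).2) := h
    exact .accept hM (by rw [h]) (hnone.1 h3.1) (hto.1 h3.2) (hptr _ h) (by rw [h])
  rcases step _ _ h with ⟨h4, h⟩ | ⟨h4, h⟩
  · replace h : γ' p = (⟨(γ p).1.M, none⟩, (γ p).2) := h
    exact .retract hM (by rw [h]) (hsome.1 h4.1) (fun h5 => h4.2.1 (hto.2 h5)) h4.2.2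
      (hptr _ h) (by rw [h])
  rcases step _ _ h with ⟨h5, h⟩ | ⟨h5, h⟩
  · replace h : γ' p = (⟨(γ p).1.M, some (γ p).2⟩, (γ p).2) := h
    exact .propose hM (by rw [h]) (hnone.1 h5.1) (hnone'.1 h5.2.1) h5.2.2.1 h5.2.2.2
      (hptr _ h) (by rw [h])
  have hne : ptr γ p = none → ptr γ (cur γ p) ≠ some p :=
    fun h7 h8 => h3 ⟨hnone.2 h7, hto.2 h8⟩
  rcases step _ _ h with ⟨h6, h⟩ | ⟨h6, h⟩
  · replace h : γ' p = ((γ p).1, nextNbr G idx p (γ p).2) := h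
    exact .advance hM (by rw [h]) (hnone.1 h6.1) (hne (hnone.1 h6.1))
      (h6.2.imp_left fun h7 => (not_congr hnone').1 h7)
      ((hptr _ h).trans (hnone.1 h6.1)) (by rw [h])
  -- No guard holds here. With pointer 0 this is impossible: the colours of `p` and of the examined
  -- neighbour differ, so the guards of actions 5 and 6 cover all cases that are left.
  rcases h1 with h1 | h1
  · rcases lt_or_gt_of_ne (hC p _ (adj_cur γ p)) with h7 | h7
    · exact absurd ⟨hnone.2 h1, by_contra fun h8 => h6 ⟨hnone.2 h1, .inl h8⟩, h7,
        fun h8 => h6 ⟨hnone.2 h1, .inr (.inr h8)⟩⟩ h5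
    · exact absurd ⟨hnone.2 h1, .inr (.inl h7)⟩ h6
  · refine .idle hM h1 ?_ h
    by_contra h7
    rw [← not_or, not_or, not_not] at h7
    exact h4 ⟨hsome.2 h1, fun h8 => h7.1 (hto.1 h8), h7.2⟩

theorem matchingProtocol_kEfficient (C : V → K)
    (idx : ∀ p, G.neighborSet p ≃ Fin (G.degree p)) :
    (matchingProtocol G C idx).KEfficient 1 := by
  intro e i p
  have hsub : e.readSet i p ⊆ {((e.conf i p).2 : G.neighborSet p).1} := by
    rintro q ⟨-, hq⟩
    refine Protocol.reads_runList_subset _ _ _ _ _ ?_ hq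
    intro a (ha : a ∈ matchingActions G C idx p)
    fin_cases ha <;> simp [Prog.reads]
  exact (Set.encard_le_encard hsub).trans (Set.encard_singleton _).le

end Moves

/-! ### Rounds of a computation -/

section Rounds

variable {V : Type u} {G : SimpleGraph V} {P : Protocol.{u, v} G} (e : P.Computation)

namespace Protocol.Computation

theorem roundEnd_add (i a b : ℕ) : e.roundEnd i (a + b) = e.roundEnd (e.roundEnd i a) b := by
  induction b with
  | zero => rfl
  | succ b ih => rw [← Nat.add_assoc, roundEnd, ih, roundEnd]

variable [Finite V]

theorem exists_mem_sel (i k : ℕ) (p : V) :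
    ∃ t, e.roundEnd i k ≤ t ∧ t < e.roundEnd i (k + 1) ∧ p ∈ e.sel t := by
  choose t ht hp using fun q => e.fair q (e.roundEnd i k)
  obtain ⟨N, hN⟩ := Set.Finite.bddAbove (Set.finite_range t)
  have hne : {j | ∀ p, ∃ t, e.roundEnd i k ≤ t ∧ t < j ∧ p ∈ e.sel t}.Nonempty :=
    ⟨N + 1, fun q => ⟨t q, ht q, Nat.lt_succ_of_le (hN ⟨q, rfl⟩), hp q⟩⟩
  exact Nat.sInf_mem hne p

theorem roundEnd_le_succ (i k : ℕ) : e.roundEnd i k ≤ e.roundEnd i (k + 1) := by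
  -- Without processes the infimum defining the next round would be 0; a selected process excludes
  -- this.
  obtain ⟨p, -⟩ := e.sel_nonempty 0
  obtain ⟨t, h1, h2, -⟩ := e.exists_mem_sel i k p
  exact h1.trans h2.le

theorem roundEnd_mono (i : ℕ) : Monotone (e.roundEnd i) :=
  monotone_nat_of_le_succ (e.roundEnd_le_succ i)

theorem le_roundEnd (i k : ℕ) : i ≤ e.roundEnd i k :=
  e.roundEnd_mono i (Nat.zero_le k)

/-- A property that is established whenever `p` is selected and that is preserved holds after the
next round. -/
theorem holds_of_round {i k J : ℕ} {p : V} {Q : ℕ → Prop}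
    (hsel : ∀ t, e.roundEnd i k ≤ t → t < J → p ∈ e.sel t → Q (t + 1))
    (hstay : ∀ t, e.roundEnd i k ≤ t → t < J → Q t → Q (t + 1)) :
    ∀ t, e.roundEnd i (k + 1) ≤ t → t ≤ J → Q t := by
  obtain ⟨s, h1, h2, h3⟩ := e.exists_mem_sel i k p
  have key : ∀ t, s + 1 ≤ t → t ≤ J → Q t := by
    intro t ht
    induction t, ht using Nat.le_induction with
    | base => exact fun hJ => hsel s h1 hJ h3
    | succ t ht ih => exact fun hJ => hstay t (by omega) hJ (ih (by omega))
  exact fun t ht => key t (by omega)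

end Protocol.Computation

end Rounds

/-! ### Cycling through the neighbours -/

section Cycle

variable {V : Type u} [Fintype V] {G : SimpleGraph V} [DecidableRel G.Adj]

theorem exists_iterate_nextNbr (idx : ∀ p, G.neighborSet p ≃ Fin (G.degree p)) (p : V)
    (c x : G.neighborSet p) : ∃ d < G.degree p, (nextNbr G idx p)^[d] c = x := by
  have key : ∀ d, (idx p ((nextNbr G idx p)^[d] c) : ℕ) = (idx p c + d) % G.degree p := by
    intro d
    induction d with
    | zero => simp [Nat.mod_eq_of_lt (idx p c).isLt]
    | succ d ih =>
      rw [Function.iterate_succ_apply', nextNbr, Equiv.apply_symm_apply]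
      simp [ih, Nat.add_assoc]
  have hpos := (idx p c).pos
  refine ⟨(idx p x + (G.degree p - idx p c)) % G.degree p, Nat.mod_lt _ hpos, ?_⟩
  apply (idx p).injective
  apply Fin.ext
  have h1 := (idx p c).isLt
  rw [key, Nat.add_mod_mod, show (idx p c : ℕ) + (idx p x + (G.degree p - idx p c)) =
    idx p x + G.degree p by omega, Nat.add_mod_right, Nat.mod_eq_of_lt (idx p x).isLt]

variable {P : Protocol.{u, v} G} (e : P.Computation)

/-- A process whose examined neighbour advances at every activation examines each neighbour at an
activation within `δ` rounds. -/
theorem exists_activation_of_cycling (idx : ∀ p, G.neighborSet p ≃ Fin (G.degree p)) (p : V)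
    (x : G.neighborSet p) (c : ℕ → G.neighborSet p) (i k : ℕ)
    (hsel : ∀ t, e.roundEnd i k ≤ t → t < e.roundEnd i (k + G.maxDegree) → p ∈ e.sel t →
      c (t + 1) = nextNbr G idx p (c t))
    (hnot : ∀ t, p ∉ e.sel t → c (t + 1) = c t) :
    ∃ t, e.roundEnd i k ≤ t ∧ t < e.roundEnd i (k + G.maxDegree) ∧ p ∈ e.sel t ∧ c t = x := by
  by_contra! hcon
  set J := e.roundEnd i (k + G.maxDegree) with hJ
  have step : ∀ t, e.roundEnd i k ≤ t → t < J → p ∈ e.sel t → ∀ m,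
      (∃ d, d + m < G.degree p ∧ (nextNbr G idx p)^[d] (c t) = x) →
      ∃ d, d + (m + 1) < G.degree p ∧ (nextNbr G idx p)^[d] (c (t + 1)) = x := by
    rintro t h1 h2 h3 m ⟨d, hd, hx⟩
    cases d with
    | zero => exact absurd hx (hcon t h1 h2 h3)
    | succ d =>
      refine ⟨d, by omega, ?_⟩
      rw [hsel t h1 h2 h3, ← Function.iterate_succ_apply]
      exact hx
  have stay : ∀ t, e.roundEnd i k ≤ t → t < J → ∀ m,
      (∃ d, d + m < G.degree p ∧ (nextNbr G idx p)^[d] (c t) = x) →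
      ∃ d, d + m < G.degree p ∧ (nextNbr G idx p)^[d] (c (t + 1)) = x := by
    intro t h1 h2 m h
    by_cases h3 : p ∈ e.sel t
    · obtain ⟨d, hd, hx⟩ := step t h1 h2 h3 m h
      exact ⟨d, by omega, hx⟩
    · rwa [hnot t h3]
  -- The cyclic distance `d` from the examined neighbour to `x` starts below the degree and loses at
  -- least one per round, as it is never 0 at an activation. After `Δ` rounds no value is left.
  have main : ∀ m, ∀ t, e.roundEnd i (k + m) ≤ t → t ≤ J →
      ∃ d, d + m < G.degree p ∧ (nextNbr G idx p)^[d] (c t) = x := by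
    intro m
    induction m with
    | zero => exact fun t _ _ => exists_iterate_nextNbr idx p (c t) x
    | succ m ih =>
      have hle := e.roundEnd_mono i (Nat.le_add_right k m)
      exact e.holds_of_round (p := p)
        (fun t h1 h2 h3 => step t (hle.trans h1) h2 h3 m (ih t h1 h2.le))
        (fun t h1 h2 h => stay t (hle.trans h1) h2 (m + 1) h)
  obtain ⟨d, hd, -⟩ := main G.maxDegree J le_rfl le_rfl
  have := G.degree_le_maxDegree p
  omega

end Cycle

/-! ### Invariants of one move -/

section Steps

variable {V : Type u} [Fintype V] {G : SimpleGraph V} [DecidableRel G.Adj] {K : Type v}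
  [LinearOrder K] {C : V → K} {idx : ∀ p, G.neighborSet p ≃ Fin (G.degree p)}
  {γ γ' : ∀ p, MState G p} {p : V}

namespace Move

theorem aligned (h : Move C idx γ γ' p) : Aligned γ' p := by
  rcases h with ⟨-, h2, h3⟩ | ⟨h1, -, -, h2, h3⟩ | ⟨-, -, -, -, h2, h3⟩ |
    ⟨-, -, -, -, -, h2, h3⟩ | ⟨-, -, -, -, -, -, h2, h3⟩ | ⟨-, -, -, -, -, h2, h3⟩ | ⟨-, h1, -, h2⟩
  · exact .inr (by rw [h2, cur_congr h3])
  · rwa [Aligned, h2, cur_congr h3]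
  · exact .inr (by rw [h2, cur_congr h3])
  · exact .inl h2
  · exact .inr (by rw [h2, cur_congr h3])
  · exact .inl h2
  · exact .inr (by rw [ptr, h2, cur, h2]; exact h1)

/-- The mark describes the old configuration `γ`: action 2 copies what it reads there, and the
actions below it run only when the mark is already right. -/
theorem M_iff (h : Move C idx γ γ' p) (hal : Aligned γ p) : (γ' p).1.M = true ↔ Wed γ p := by
  rcases h with ⟨h1, -, -⟩ | ⟨-, -, h, -, -⟩ | ⟨h, h', -, -, -, -⟩ |
    ⟨h, h', -, -, -, -, -⟩ | ⟨h, h', -, -, -, -, -, -⟩ | ⟨h, h', -, -, -, -, -⟩ | ⟨h, -, -, h2⟩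
  · exact absurd hal h1
  · exact h
  · rwa [h']
  · rwa [h']
  · rwa [h']
  · rwa [h']
  · rwa [h2]

/-- A process keeps its pointer if the target points back or has no reason to be abandoned. -/
theorem ptr_eq (h : Move C idx γ γ' p) (hal : Aligned γ p) {x : V} (hx : ptr γ p = some x)
    (hx' : ptr γ x = some p ∨ ¬ (γ x).1.M = true ∧ ¬ C x < C p) : ptr γ' p = some x := by
  rcases h with ⟨h1, -, -⟩ | ⟨-, -, -, h, -⟩ | ⟨-, -, h, -, -, -⟩ |
    ⟨-, -, h, h1, h2, -, -⟩ | ⟨-, -, h, -, -, -, -, -⟩ | ⟨-, -, h, -, -, -, -⟩ | ⟨-, -, -, h⟩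
  · exact absurd hal h1
  · rw [h, hx]
  · simp [h] at hx
  · obtain rfl : cur γ p = x := by simpa [h] using hx
    rcases hx' with h3 | h3
    · exact absurd h3 h1
    · exact absurd h2 (by rw [not_or]; exact h3)
  · simp [h] at hx
  · simp [h] at hx
  · rw [ptr, h]; exact hx

end Move

end Steps

/-! ### Persistence of marriages and progress -/

section Runs

variable {V : Type u} [Fintype V] {G : SimpleGraph V} [DecidableRel G.Adj] {K : Type v}
  [LinearOrder K] {C : V → K} {idx : ∀ p, G.neighborSet p ≃ Fin (G.degree p)}
  (e : (matchingProtocol G C idx).Computation) (hC : ∀ p q, G.Adj p q → C p ≠ C q)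

include hC

theorem move_of_mem_sel {t : ℕ} {p : V} (h : p ∈ e.sel t) :
    Move C idx (e.conf t) (e.conf (t + 1)) p :=
  move_of_eq_exec hC (e.step_sel t p h)

theorem aligned_succ {t : ℕ} {p : V} (h : Aligned (e.conf t) p) : Aligned (e.conf (t + 1)) p := by
  by_cases hp : p ∈ e.sel t
  · exact (move_of_mem_sel e hC hp).aligned
  · have := e.step_not_sel t p hp
    exact h.congr this

theorem aligned_of_le {i t : ℕ} (hit : i ≤ t) (hal : ∀ p, Aligned (e.conf i) p) (p : V) :
    Aligned (e.conf t) p := by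
  induction t, hit using Nat.le_induction with
  | base => exact hal p
  | succ t _ ih => exact aligned_succ e hC ih

theorem aligned_of_roundEnd_le {t : ℕ} (ht : e.roundEnd 0 1 ≤ t) (p : V) :
    Aligned (e.conf t) p :=
  e.holds_of_round (Q := fun t => Aligned (e.conf t) p)
    (fun _ _ _ hp => (move_of_mem_sel e hC hp).aligned)
    (fun _ _ _ h => aligned_succ e hC h) t ht le_rfl

theorem ptr_succ {t : ℕ} {p x : V} (hal : Aligned (e.conf t) p) (hx : ptr (e.conf t) p = some x)
    (hx' : ptr (e.conf t) x = some p ∨ ¬ (e.conf t x).1.M = true ∧ ¬ C x < C p) :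
    ptr (e.conf (t + 1)) p = some x := by
  by_cases hp : p ∈ e.sel t
  · exact (move_of_mem_sel e hC hp).ptr_eq hal hx hx'
  · rwa [ptr_congr (e.step_not_sel t p hp)]

/-- Alignment disables action 1, and a pointer that is returned disables action 4; no other action
changes a nonzero pointer. -/
theorem partner_of_le {i t : ℕ} (hit : i ≤ t) (hal : ∀ p, Aligned (e.conf i) p) {p q : V}
    (hp : ptr (e.conf i) p = some q) (hq : ptr (e.conf i) q = some p) :
    ptr (e.conf t) p = some q ∧ ptr (e.conf t) q = some p := by
  induction t, hit using Nat.le_induction with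
  | base => exact ⟨hp, hq⟩
  | succ t ht ih =>
    have hal' := aligned_of_le e hC ht hal
    exact ⟨ptr_succ e hC (hal' p) ih.1 (.inl ih.2), ptr_succ e hC (hal' q) ih.2 (.inl ih.1)⟩

theorem married_of_le {i t : ℕ} (hit : i ≤ t) (hal : ∀ p, Aligned (e.conf i) p) {p : V}
    (h : Married (e.conf i) p) : Married (e.conf t) p := by
  obtain ⟨q, h1, h2⟩ := (married_iff _ _).1 h
  exact (married_iff _ _).2 ⟨q, partner_of_le e hC hit hal h1 h2⟩

theorem M_of_married {i t : ℕ} (hal : ∀ p, Aligned (e.conf i) p) {p : V}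
    (h : Married (e.conf i) p) (ht : e.roundEnd i 1 ≤ t) : (e.conf t p).1.M = true := by
  have hsel : ∀ s, i ≤ s → p ∈ e.sel s → (e.conf (s + 1) p).1.M = true := fun s hs hp => by
    have hal' := aligned_of_le e hC hs hal p
    exact ((move_of_mem_sel e hC hp).M_iff hal').2 (hal'.wed_iff.2 (married_of_le e hC hs hal h))
  refine e.holds_of_round (i := i) (k := 0) (p := p) (Q := fun t => (e.conf t p).1.M = true)
    (fun s hs _ hp => hsel s hs hp) (fun s hs _ h => ?_) t ht le_rfl
  by_cases hp : p ∈ e.sel s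
  · exact hsel s hs hp
  · rwa [e.step_not_sel s p hp]

/-- It matters that `p` is unmarried at the end `t`: marriages persist, so no activation of `p`
between `i` and `t` can have seen a marriage to record. -/
theorem not_M_of_not_married {i t : ℕ} (hal : ∀ p, Aligned (e.conf i) p) {p : V}
    (h : ¬ Married (e.conf t) p) (ht : e.roundEnd i 1 ≤ t) : ¬ (e.conf t p).1.M = true := by
  have hsel : ∀ s, i ≤ s → s < t → p ∈ e.sel s → ¬ (e.conf (s + 1) p).1.M = true :=
    fun s hs hst hp => by
      have hal' := aligned_of_le e hC hs hal
      rw [(move_of_mem_sel e hC hp).M_iff (hal' p), (hal' p).wed_iff]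
      exact fun h' => h (married_of_le e hC hst.le hal' h')
  refine e.holds_of_round (i := i) (k := 0) (p := p) (Q := fun t => ¬ (e.conf t p).1.M = true)
    hsel (fun s hs hst h => ?_) t ht le_rfl
  by_cases hp : p ∈ e.sel s
  · exact hsel s hs hst hp
  · rwa [e.step_not_sel s p hp]

/-- Connectedness of `A` plays no role, so the statement also serves for the set of all unmarried
processes. -/
theorem exists_married_of_adj {i : ℕ} (hal : ∀ p, Aligned (e.conf i) p) {A : Set V}
    (hA : ∀ p ∈ A, ∀ q, G.Adj p q → q ∈ A ∨ Married (e.conf i) q) {u v : V} (hu : u ∈ A)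
    (hv : v ∈ A) (huv : G.Adj u v) :
    ∃ p ∈ A, Married (e.conf (e.roundEnd i (2 * G.maxDegree + 2))) p := by
  by_contra! hcon
  set J := e.roundEnd i (2 * G.maxDegree + 2) with hJ
  have hR : ∀ k, i ≤ e.roundEnd i k := e.le_roundEnd i
  have hR12 : e.roundEnd i 1 ≤ e.roundEnd i 2 := e.roundEnd_mono i (by omega)
  have hal' : ∀ {t}, i ≤ t → ∀ p, Aligned (e.conf t) p := fun ht => aligned_of_le e hC ht hal
  have hU : ∀ t, i ≤ t → t ≤ J → ∀ p ∈ A, ¬ Married (e.conf t) p := fun t h1 h2 p hp h =>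
    hcon p hp (married_of_le e hC h2 (hal' h1) h)
  have hW : ∀ t, i ≤ t → t ≤ J → ∀ p ∈ A, ¬ Wed (e.conf t) p := fun t h1 h2 p hp h =>
    hU t h1 h2 p hp h.married
  have hM : ∀ t, e.roundEnd i 1 ≤ t → t ≤ J → ∀ p ∈ A, ¬ (e.conf t p).1.M = true :=
    fun t h1 h2 p hp => not_M_of_not_married e hC hal (hU t ((hR 1).trans h1) h2 p hp) h1
  -- A neighbour married at `i` still points at its spouse; if it points at `p`, then `p` is that
  -- spouse.
  have hmem : ∀ t, i ≤ t → t ≤ J → ∀ p ∈ A, ∀ q, G.Adj p q → ptr (e.conf t) q = some p →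
      q ∈ A := by
    intro t h1 h2 p hp q hpq hq
    refine (hA p hp q hpq).resolve_right fun hm => ?_
    obtain ⟨r, h3, h4⟩ := (married_iff _ _).1 hm
    have h5 := partner_of_le e hC h1 hal h3 h4
    obtain rfl : p = r := by simpa [hq] using h5.1
    exact hU t h1 h2 p hp ((married_iff _ _).2 ⟨q, h5.2, h5.1⟩)
  have hmem' : ∀ t, e.roundEnd i 1 ≤ t → ∀ p ∈ A, ∀ q, G.Adj p q →
      ¬ (e.conf t q).1.M = true → q ∈ A := fun t h1 p hp q hpq hq =>
    (hA p hp q hpq).resolve_right fun hm => hq (M_of_married e hC hal hm h1)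
  have hlt : ∀ {p q}, G.Adj p q → ¬ C q < C p → C p < C q := fun h1 h2 =>
    lt_of_le_of_ne (not_lt.1 h2) (hC _ _ h1)
  -- after two rounds all pointers inside `A` go upwards
  have hup_succ : ∀ t, e.roundEnd i 1 ≤ t → t < J → ∀ p ∈ A,
      (ptr (e.conf t) p = none ∨ ∃ x ∈ A, ptr (e.conf t) p = some x ∧ C p < C x) →
      (ptr (e.conf (t + 1)) p = none ∨
        ∃ x ∈ A, ptr (e.conf (t + 1)) p = some x ∧ C p < C x) := by
    rintro t h1 h2 p hp (h | ⟨x, hx, h3, h4⟩)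
    · by_cases hs : p ∈ e.sel t
      · have hit := (hR 1).trans h1
        rcases move_of_mem_sel e hC hs with ⟨h3, -, -⟩ | ⟨-, -, -, h3, -⟩ | ⟨-, -, -, h3, h4, -⟩ |
          ⟨-, -, h3, -, -, -, -⟩ | ⟨-, -, -, -, h3, h4, h5, -⟩ | ⟨-, -, -, -, -, h3, -⟩ |
          ⟨-, h3, -, -⟩
        · exact absurd (hal' hit p) h3
        · exact .inl (h3.trans h)
        · have hadj := adj_cur (e.conf t) p
          refine .inr ⟨_, hmem t hit h2.le p hp _ hadj h3, h4, hlt hadj fun h5 => ?_⟩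
          -- Accepting a smaller neighbour would create a marriage: that neighbour points upwards at
          -- the unmarked `p`, so it cannot retract in the same step.
          have h6 := ptr_succ e hC (hal' hit _) h3 (.inr ⟨hM t h1 h2.le p hp, not_lt_of_gt h5⟩)
          exact hU (t + 1) (by omega) h2 p hp ((married_iff _ _).2 ⟨_, h4, h6⟩)
        · simp [h] at h3
        · exact .inr ⟨_, hmem' t h1 p hp _ (adj_cur _ p) h4, h5, h3⟩
        · exact .inl h3
        · simp [h] at h3
      · exact .inl (by rwa [ptr_congr (e.step_not_sel t p hs)])
    · exact .inr ⟨x, hx, ptr_succ e hC (hal' ((hR 1).trans h1) p) h3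
        (.inr ⟨hM t h1 h2.le x hx, not_lt_of_gt h4⟩), h4⟩
  have hup : ∀ p ∈ A, ∀ t, e.roundEnd i 2 ≤ t → t ≤ J →
      (ptr (e.conf t) p = none ∨ ∃ x ∈ A, ptr (e.conf t) p = some x ∧ C p < C x) := by
    intro p hp
    refine e.holds_of_round (p := p) (fun t h1 h2 hs => ?_) fun t h1 h2 h => hup_succ t h1 h2 p hp h
    have hit := (hR 1).trans h1
    by_cases h : ptr (e.conf t) p = none
    · exact hup_succ t h1 h2 p hp (.inl h)
    rcases move_of_mem_sel e hC hs with ⟨h3, -, -⟩ | ⟨-, h3, -, -, -⟩ | ⟨-, -, h3, -, -, -⟩ |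
      ⟨-, -, -, -, -, h3, -⟩ | ⟨-, -, h3, -, -, -, -, -⟩ | ⟨-, -, h3, -, -, -, -⟩ | ⟨-, h3, h4, -⟩
    · exact absurd (hal' hit p) h3
    · exact absurd (iff_of_false (hM t h1 h2.le p hp) (hW t hit h2.le p hp)) h3
    · exact absurd h3 h
    · exact .inl h3
    · exact absurd h3 h
    · exact absurd h3 h
    · rcases h4 with h4 | h4
      · exact absurd ⟨h3, h4⟩ (hW t hit h2.le p hp)
      · exact hup_succ t h1 h2 p hp (.inr ⟨_, hmem' t h1 p hp _ (adj_cur _ p) h4.1, h3,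
          hlt (adj_cur _ p) h4.2⟩)
  -- The target is unmarked and has larger colour, so action 4 is disabled from now on.
  have hkeep : ∀ p ∈ A, ∀ s, e.roundEnd i 2 ≤ s → ∀ x, ptr (e.conf s) p = some x →
      ∀ t, s ≤ t → t ≤ J → ptr (e.conf t) p = some x := by
    intro p hp s hs x hx t hst
    induction t, hst using Nat.le_induction with
    | base => exact fun _ => hx
    | succ t ht ih =>
      intro h2
      have h3 := ih (by omega)
      rcases hup p hp t (hs.trans ht) (by omega) with h4 | ⟨y, hy, h4, h5⟩
      · simp [h4] at h3
      · obtain rfl : y = x := by simpa [h3] using h4.symm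
        exact ptr_succ e hC (hal' ((hR 2).trans (hs.trans ht)) p) h3
          (.inr ⟨hM t (hR12.trans (hs.trans ht)) (by omega) y hy, not_lt_of_gt h5⟩)
  have hback : ∀ p ∈ A, ∀ s, e.roundEnd i 2 ≤ s → ∀ t, s ≤ t → t ≤ J →
      ptr (e.conf t) p = none → ptr (e.conf s) p = none := by
    intro p hp s hs t hst ht h
    by_contra h1
    obtain ⟨x, hx⟩ := Option.ne_none_iff_exists'.1 h1
    simp [hkeep p hp s hs x hx t hst ht] at h
  -- a process of `A` with pointer `0` goes through all its neighbours
  have hcyc : ∀ p ∈ A, ∀ k, 2 ≤ k → k + G.maxDegree ≤ 2 * G.maxDegree + 2 →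
      (∀ t, e.roundEnd i k ≤ t → t ≤ e.roundEnd i (k + G.maxDegree) → ptr (e.conf t) p = none) →
      ∀ x, G.Adj p x → ∃ t, e.roundEnd i k ≤ t ∧ t < e.roundEnd i (k + G.maxDegree) ∧
        ptr (e.conf t) x ≠ some p ∧
          (ptr (e.conf t) x ≠ none ∨ C x < C p ∨ (e.conf t x).1.M = true) := by
    intro p hp k hk hk' hz x hx
    have hkJ : e.roundEnd i (k + G.maxDegree) ≤ J := e.roundEnd_mono i hk'
    have h1k : e.roundEnd i 1 ≤ e.roundEnd i k := e.roundEnd_mono i (by omega)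
    have key : ∀ t, e.roundEnd i k ≤ t → t < e.roundEnd i (k + G.maxDegree) → p ∈ e.sel t →
        (ptr (e.conf t) (cur (e.conf t) p) ≠ some p ∧ (ptr (e.conf t) (cur (e.conf t) p) ≠ none ∨
          C (cur (e.conf t) p) < C p ∨ (e.conf t (cur (e.conf t) p)).1.M = true)) ∧
        (e.conf (t + 1) p).2 = nextNbr G idx p (e.conf t p).2 := by
      intro t h1 h2 hs
      have hit := (hR k).trans h1
      have hn := hz t h1 h2.le
      have hn' := hz (t + 1) (by omega) h2
      rcases move_of_mem_sel e hC hs with ⟨h3, -, -⟩ | ⟨-, h3, -, -, -⟩ | ⟨-, -, -, -, h3, -⟩ |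
        ⟨-, -, h3, -, -, -, -⟩ | ⟨-, -, -, -, -, -, h3, -⟩ | ⟨-, -, -, h3, h4, -, h5⟩ |
        ⟨-, h3, -, -⟩
      · exact absurd (hal' hit p) h3
      · exact absurd (iff_of_false (hM t (h1k.trans h1) (h2.le.trans hkJ) p hp)
          (hW t hit (h2.le.trans hkJ) p hp)) h3
      · simp [hn'] at h3
      · simp [hn] at h3
      · simp [hn'] at h3
      · exact ⟨⟨h3, h4⟩, h5⟩
      · simp [hn] at h3
    obtain ⟨t, h1, h2, h3, h4⟩ := exists_activation_of_cycling e idx p ⟨x, hx⟩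
      (fun t => (e.conf t p).2) i k (fun t h1 h2 hs => (key t h1 h2 hs).2)
      (fun t hs => congrArg Prod.snd (e.step_not_sel t p hs))
    have h5 : cur (e.conf t) p = x := congrArg Subtype.val h4
    refine ⟨t, h1, h2, ?_⟩
    rw [← h5]
    exact (key t h1 h2 h3).1
  set T := e.roundEnd i (2 + G.maxDegree) with hT
  have hTJ : T ≤ J := e.roundEnd_mono i (by omega)
  have h2T : e.roundEnd i 2 ≤ T := e.roundEnd_mono i (by omega)
  -- If both pointers are 0 at `T`, they were 0 since the second round, and `p` would have proposed
  -- when it examined `x`.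
  have hpend : ∀ p ∈ A, ptr (e.conf T) p = none → ∀ x ∈ A, G.Adj p x → C p < C x →
      ptr (e.conf T) x ≠ none := by
    intro p hp hpn x hx hpx hlt' hxn
    obtain ⟨t, h1, h2, -, h4⟩ := hcyc p hp 2 le_rfl (by omega)
      (fun t h1 h2 => hback p hp t h1 T h2 hTJ hpn) x hpx
    rcases h4 with h4 | h4 | h4
    · exact h4 (hback x hx t h1 T h2.le hTJ hxn)
    · exact not_lt_of_gt hlt' h4
    · exact hM t (hR12.trans h1) (h2.le.trans hTJ) x hx h4
  have hex : {p | p ∈ A ∧ ptr (e.conf T) p ≠ none}.Nonempty := by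
    by_contra hne
    rw [Set.not_nonempty_iff_eq_empty, Set.eq_empty_iff_forall_notMem] at hne
    have hall : ∀ p ∈ A, ptr (e.conf T) p = none := fun p hp => by_contra fun h => hne p ⟨hp, h⟩
    rcases lt_or_gt_of_ne (hC u v huv) with h | h
    · exact hpend u hu (hall u hu) v hv huv h (hall v hv)
    · exact hpend v hv (hall v hv) u hu huv.symm h (hall u hu)
  obtain ⟨p, ⟨hp, hpn⟩, hmax⟩ := Set.exists_max_image _ C (Set.toFinite _) hex
  obtain ⟨q, hq, hpq, hlt'⟩ := (hup p hp T h2T hTJ).resolve_left hpn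
  have hqn : ptr (e.conf T) q = none := by
    by_contra h
    exact absurd hlt' (not_lt.2 (hmax q ⟨hq, h⟩))
  have hadj : G.Adj q p := by
    have h1 := (hal' (hR _) p : Aligned (e.conf T) p).resolve_left hpn
    obtain rfl : cur (e.conf T) p = q := Option.some.inj (h1.symm.trans hpq)
    exact (adj_cur _ p).symm
  -- Accepting would marry `q`, as the suitor keeps its pointer; proposing needs a larger member of
  -- `A` with pointer 0, excluded by `hpend`.
  have hqz : ∀ t, T ≤ t → t ≤ J → ptr (e.conf t) q = none := by
    intro t ht
    induction t, ht using Nat.le_induction with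
    | base => exact fun _ => hqn
    | succ t ht ih =>
      intro h2
      have hn := ih (by omega)
      have hit : i ≤ t := (hR _).trans ht
      have h2t := h2T.trans ht
      by_cases hs : q ∈ e.sel t
      · rcases move_of_mem_sel e hC hs with ⟨h3, -, -⟩ | ⟨-, -, -, h3, -⟩ |
          ⟨-, -, -, h3, h4, -⟩ | ⟨-, -, h3, -, -, -, -⟩ | ⟨-, -, -, h3, h4, h5, -, -⟩ |
          ⟨-, -, -, -, -, h3, -⟩ | ⟨-, h3, -, -⟩
        · exact absurd (hal' hit q) h3
        · exact h3.trans hn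
        · have hc := hmem t hit (by omega) q hq _ (adj_cur _ q) h3
          have h5 := hkeep _ hc t h2t q h3 (t + 1) (by omega) h2
          exact absurd ((married_iff _ _).2 ⟨_, h4, h5⟩) (hU (t + 1) (by omega) h2 q hq)
        · simp [hn] at h3
        · have hc := hmem' t (hR12.trans h2t) q hq _ (adj_cur _ q) h5
          exact absurd (hback _ hc T h2T t ht (by omega) h3)
            (hpend q hq hqn _ hc (adj_cur _ q) h4)
        · exact h3
        · simp [hn] at h3
      · rwa [ptr_congr (e.step_not_sel t q hs)]
  have hTJ' : e.roundEnd i (2 + G.maxDegree + G.maxDegree) = J := by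
    rw [hJ]; congr 1; omega
  obtain ⟨t, h1, h2, h3, -⟩ := hcyc q hq (2 + G.maxDegree) (by omega) (by omega)
    (fun t h1 h2 => hqz t h1 (h2.trans hTJ'.le)) p hadj
  exact h3 (hkeep p hp T h2T q hpq t h1 (h2.le.trans hTJ'.le))

end Runs

/-! ### Settled configurations, the round bound and silence -/

section Settled

variable {V : Type u} {G : SimpleGraph V}

theorem adj_of_ptr {γ : ∀ p, MState G p} {p q : V} (h : ptr γ p = some q) : G.Adj p q := by
  obtain ⟨r, -, rfl⟩ := Option.map_eq_some_iff.1 h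
  exact r.2

theorem Married.ptr_target {γ : ∀ p, MState G p} {p q : V} (h : Married γ p)
    (hq : ptr γ p = some q) : ptr γ q = some p := by
  obtain ⟨r, h1, h2⟩ := (married_iff γ p).1 h
  obtain rfl : q = r := by simpa [hq] using h1
  exact h2

theorem married_congr {γ γ' : ∀ p, MState G p} (h : ∀ p, (γ' p).1 = (γ p).1) (p : V) :
    Married γ' p ↔ Married γ p := by
  simp only [Married, h]

/-- The configurations in which the communication variables have reached their final values. -/
structure Settled (γ : ∀ p, MState G p) : Prop where
  aligned : ∀ p, Aligned γ p
  M_iff : ∀ p, (γ p).1.M = true ↔ Married γ p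
  ptr_eq_none : ∀ p, ¬ Married γ p → ptr γ p = none
  married_or : ∀ p q, G.Adj p q → Married γ p ∨ Married γ q

theorem Married.ptr_ne_none {γ : ∀ p, MState G p} {p : V} (h : Married γ p) :
    ptr γ p ≠ none := by
  obtain ⟨r, h1, -⟩ := (married_iff γ p).1 h
  simp [h1]

theorem ncard_not_married_add_two_le [Finite V] {A : Set V} {γ : ∀ p, MState G p} {p q : V}
    (hp : p ∈ A) (hq : q ∈ A) (hpq : p ≠ q)
    (hp' : Married γ p) (hq' : Married γ q) :
    {p ∈ A | ¬ Married γ p}.ncard + 2 ≤ A.ncard := by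
  have hsub : ({p, q} : Set V) ⊆ A := by
    rintro x (rfl | rfl) <;> assumption
  rw [← Set.ncard_sdiff_add_ncard_of_subset hsub, Set.ncard_pair hpq]
  refine Nat.add_le_add_right (Set.ncard_le_ncard ?_ (Set.toFinite _)) 2
  rintro x ⟨hx, hx'⟩
  refine ⟨hx, ?_⟩
  rintro (rfl | rfl)
  · exact hx' hp'
  · exact hx' hq'

variable [Fintype V] [DecidableRel G.Adj] {K : Type v} [LinearOrder K] {C : V → K}
  {idx : ∀ p, G.neighborSet p ≃ Fin (G.degree p)}

/-- Only `cur` can still change: nonzero pointers are returned, which excludes accepting and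
retracting, and a proposal would need two adjacent unmarried processes. -/
theorem Move.comm_eq {γ γ' : ∀ p, MState G p} {p : V} (h : Move C idx γ γ' p) (hs : Settled γ) :
    (γ' p).1 = (γ p).1 := by
  have hal := hs.aligned p
  refine comm_ext ((h.M_iff hal).trans (hal.wed_iff.trans (hs.M_iff p).symm)) ?_
  have hm : ∀ q, ptr γ q ≠ none → Married γ q := fun q hq =>
    by_contra fun h => hq (hs.ptr_eq_none q h)
  rcases h with ⟨h1, -, -⟩ | ⟨-, -, -, h1, -⟩ | ⟨-, -, h1, h2, -, -⟩ |
    ⟨-, -, h1, h2, -, -, -⟩ | ⟨-, -, h1, h2, -, -, -, -⟩ | ⟨-, -, h1, -, -, h2, -⟩ |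
    ⟨-, -, -, h1⟩
  · exact absurd hal h1
  · exact h1
  · have h3 := (hm (cur γ p) (by simp [h2])).ptr_target h2
    simp [h1] at h3
  · exact absurd ((hm p (by simp [h1])).ptr_target h1) h2
  · rcases hs.married_or p _ (adj_cur γ p) with h3 | h3
    · exact absurd h1 h3.ptr_ne_none
    · exact absurd h2 h3.ptr_ne_none
  · rw [h1, h2]
  · rw [ptr_congr h1]

variable (e : (matchingProtocol G C idx).Computation)

/-- The computation from `γ` in which all processes are selected in every step. -/
noncomputable def synchronous [Nonempty V] (P : Protocol.{u, v} G) (γ : P.Config) :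
    P.Computation where
  conf i := (fun γ p => P.exec γ p)^[i] γ
  sel _ := Set.univ
  sel_nonempty _ := Set.univ_nonempty
  step_sel i p _ := by rw [Function.iterate_succ_apply']
  step_not_sel i p hp := absurd (Set.mem_univ p) hp
  fair p N := ⟨N, le_rfl, Set.mem_univ p⟩

variable (hC : ∀ p q, G.Adj p q → C p ≠ C q)

include hC

theorem Settled.comm_succ {t : ℕ} (hs : Settled (e.conf t)) (p : V) :
    (e.conf (t + 1) p).1 = (e.conf t p).1 := by
  by_cases hp : p ∈ e.sel t
  · exact (move_of_mem_sel e hC hp).comm_eq hs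
  · rw [e.step_not_sel t p hp]

theorem Settled.succ {t : ℕ} (hs : Settled (e.conf t)) : Settled (e.conf (t + 1)) := by
  have hcomm := hs.comm_succ e hC
  have hmar := married_congr (γ := e.conf t) (γ' := e.conf (t + 1)) hcomm
  refine ⟨fun p => aligned_succ e hC (hs.aligned p), fun p => ?_, fun p hp => ?_,
    fun p q hpq => ?_⟩
  · rw [hmar, hcomm]
    exact hs.M_iff p
  · rw [hmar] at hp
    rw [← hs.ptr_eq_none p hp]
    exact congrArg (fun x : MComm G p => x.PR.map Subtype.val) (hcomm p)
  · rw [hmar, hmar]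
    exact hs.married_or p q hpq

theorem Settled.silent {γ : ∀ p, MState G p} (hs : Settled γ) :
    (matchingProtocol G C idx).Silent γ := by
  rintro e rfl i
  have key : ∀ i, Settled (e.conf i) ∧ ∀ p, (e.conf i p).1 = (e.conf 0 p).1 := by
    intro i
    induction i with
    | zero => exact ⟨hs, fun _ => rfl⟩
    | succ i ih => exact ⟨ih.1.succ e hC, fun p => (ih.1.comm_succ e hC p).trans (ih.2 p)⟩
  exact (key i).2

/-- When no two unmarried processes are adjacent, no further process gets married. -/
theorem married_iff_of_maximal {i t : ℕ} (hit : i ≤ t) (hal : ∀ p, Aligned (e.conf i) p)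
    (hmax : ∀ p q, G.Adj p q → Married (e.conf i) p ∨ Married (e.conf i) q) (p : V) :
    Married (e.conf t) p ↔ Married (e.conf i) p := by
  refine ⟨fun h => ?_, married_of_le e hC hit hal⟩
  obtain ⟨q, h1, h2⟩ := (married_iff _ _).1 h
  refine (hmax p q (adj_of_ptr h1)).elim id fun h => ?_
  obtain ⟨r, h3, h4⟩ := (married_iff _ _).1 h
  obtain rfl : p = r := by simpa [h2] using (partner_of_le e hC hit hal h3 h4).1
  exact (married_iff _ _).2 ⟨q, h4, h3⟩

theorem M_iff_married {i t : ℕ} (hal : ∀ p, Aligned (e.conf i) p)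
    (hmax : ∀ p q, G.Adj p q → Married (e.conf i) p ∨ Married (e.conf i) q)
    (ht : e.roundEnd i 1 ≤ t) (p : V) : (e.conf t p).1.M = true ↔ Married (e.conf t) p := by
  have hiff := married_iff_of_maximal e hC ((e.le_roundEnd i 1).trans ht) hal hmax p
  by_cases hm : Married (e.conf i) p
  · exact iff_of_true (M_of_married e hC hal hm ht) (hiff.2 hm)
  · have hm' := fun h => hm (hiff.1 h)
    exact iff_of_false (not_M_of_not_married e hC hal hm' ht) hm'

/-- One round suffices, since there is no unmarried process whose pointer must be withdrawn. -/
theorem settled_of_married {i : ℕ} (hal : ∀ p, Aligned (e.conf i) p)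
    (hmar : ∀ p, Married (e.conf i) p) : Settled (e.conf (e.roundEnd i 1)) := by
  have hi := e.le_roundEnd i 1
  have hmar' : ∀ p, Married (e.conf (e.roundEnd i 1)) p := fun p =>
    married_of_le e hC hi hal (hmar p)
  exact ⟨aligned_of_le e hC hi hal, M_iff_married e hC hal (fun p _ _ => .inl (hmar p)) le_rfl,
    fun p hp => absurd (hmar' p) hp, fun p _ _ => .inl (hmar' p)⟩

/-- The first round corrects the marks. In the second, an unmarried process with a nonzero pointer
sees a marked neighbour that does not point back, and retracts; afterwards it can neither propose
nor accept. -/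
theorem settled_of_maximal {i : ℕ} (hal : ∀ p, Aligned (e.conf i) p)
    (hmax : ∀ p q, G.Adj p q → Married (e.conf i) p ∨ Married (e.conf i) q) :
    Settled (e.conf (e.roundEnd i 2)) := by
  have hi := e.le_roundEnd i
  have hiff := fun {t} (ht : i ≤ t) => married_iff_of_maximal e hC ht hal hmax
  refine ⟨aligned_of_le e hC (hi 2) hal,
    M_iff_married e hC hal hmax (e.roundEnd_mono i (by omega)), fun p hp => ?_, fun p q hpq => ?_⟩
  · rw [hiff (hi 2)] at hp
    have hsel : ∀ t, e.roundEnd i 1 ≤ t → p ∈ e.sel t → ptr (e.conf (t + 1)) p = none := by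
      intro t h1 hs
      have hit := (hi 1).trans h1
      have hal' := aligned_of_le e hC hit hal
      have hpt : ¬ Married (e.conf t) p := by rwa [hiff hit]
      have hcm : Married (e.conf i) (cur (e.conf t) p) :=
        (hmax p _ (adj_cur (e.conf t) p)).resolve_left hp
      have hcM := M_of_married e hC hal hcm h1
      have hcp : ptr (e.conf t) (cur (e.conf t) p) ≠ some p := fun h =>
        hpt ((married_iff _ _).2 ⟨_, ((hiff hit _).2 hcm).ptr_target h, h⟩)
      have hM := (M_iff_married e hC hal hmax h1 p).trans (hal' p).wed_iff.symm
      rcases move_of_mem_sel e hC hs with ⟨h3, -, -⟩ | ⟨-, h3, -, -, -⟩ | ⟨-, -, -, h3, -, -⟩ |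
        ⟨-, -, -, -, -, h3, -⟩ | ⟨-, -, -, -, -, h3, -, -⟩ | ⟨-, -, -, -, -, h3, -⟩ |
        ⟨-, -, h3 | h3, -⟩
      · exact absurd (hal' p) h3
      · exact absurd hM h3
      · exact absurd h3 hcp
      · exact h3
      · exact absurd hcM h3
      · exact h3
      · exact absurd h3 hcp
      · exact absurd hcM h3.1
    refine e.holds_of_round (i := i) (k := 1) (p := p) (Q := fun t => ptr (e.conf t) p = none)
      (fun t h1 _ hs => hsel t h1 hs) (fun t h1 _ h => ?_) _ le_rfl le_rfl
    by_cases hs : p ∈ e.sel t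
    · exact hsel t h1 hs
    · rwa [ptr_congr (e.step_not_sel t p hs)]
  · rw [hiff (hi 2), hiff (hi 2)]
    exact hmax p q hpq

/-- The second process is the spouse of the first. It lies in `A`, as otherwise it was already
married at `i`, necessarily to the same process of `A`. -/
theorem ncard_unmarried_add_two_le {i : ℕ} (hal : ∀ p, Aligned (e.conf i) p) {A : Set V}
    (hA : ∀ p ∈ A, ¬ Married (e.conf i) p)
    (hA' : ∀ p ∈ A, ∀ q, G.Adj p q → q ∈ A ∨ Married (e.conf i) q) {u v : V} (hu : u ∈ A)
    (hv : v ∈ A) (huv : G.Adj u v) {j : ℕ} (hj : e.roundEnd i (2 * G.maxDegree + 2) ≤ j) :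
    {p ∈ A | ¬ Married (e.conf j) p}.ncard + 2 ≤ A.ncard := by
  obtain ⟨p, hp, hm⟩ := exists_married_of_adj e hC hal hA' hu hv huv
  have hi := e.le_roundEnd i (2 * G.maxDegree + 2)
  have hmj := married_of_le e hC hj (aligned_of_le e hC hi hal) hm
  obtain ⟨q, h1, h2⟩ := (married_iff _ _).1 hmj
  have hadj := adj_of_ptr h1
  refine ncard_not_married_add_two_le hp ((hA' p hp q hadj).resolve_right fun h => ?_)
    hadj.ne hmj ((married_iff _ _).2 ⟨p, h2, h1⟩)
  obtain ⟨r, h3, h4⟩ := (married_iff _ _).1 h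
  obtain rfl : p = r := by simpa [h2] using (partner_of_le e hC (hi.trans hj) hal h3 h4).1
  exact hA p hp ((married_iff _ _).2 ⟨q, h4, h3⟩)

/-- Block by block, with `A` the set of all unmarried processes: as long as this set contains an
edge, it loses two elements per block. -/
theorem maximal_or_ncard_le (k : ℕ) :
    (∃ l < k, ∀ p q, G.Adj p q →
      Married (e.conf (e.roundEnd 0 (1 + l * (2 * G.maxDegree + 2)))) p ∨
        Married (e.conf (e.roundEnd 0 (1 + l * (2 * G.maxDegree + 2)))) q) ∨
    {p | ¬ Married (e.conf (e.roundEnd 0 (1 + k * (2 * G.maxDegree + 2)))) p}.ncard + 2 * k ≤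
      Fintype.card V := by
  induction k with
  | zero =>
    right
    rw [← Nat.card_eq_fintype_card, ← Set.ncard_univ]
    exact Set.ncard_le_ncard (Set.subset_univ _) (Set.toFinite _)
  | succ k ih =>
    rcases ih with ⟨l, hl, h⟩ | h
    · exact .inl ⟨l, by omega, h⟩
    by_cases hmax : ∀ p q, G.Adj p q →
        Married (e.conf (e.roundEnd 0 (1 + k * (2 * G.maxDegree + 2)))) p ∨
          Married (e.conf (e.roundEnd 0 (1 + k * (2 * G.maxDegree + 2)))) q
    · exact .inl ⟨k, by omega, hmax⟩
    push Not at hmax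
    obtain ⟨u, v, huv, hu, hv⟩ := hmax
    right
    have hal := aligned_of_roundEnd_le e hC
      (e.roundEnd_mono 0 (Nat.le_add_right 1 (k * (2 * G.maxDegree + 2))))
    have heq : e.roundEnd 0 (1 + (k + 1) * (2 * G.maxDegree + 2)) =
        e.roundEnd (e.roundEnd 0 (1 + k * (2 * G.maxDegree + 2))) (2 * G.maxDegree + 2) := by
      rw [← e.roundEnd_add]
      congr 1
      ring
    have h1 := ncard_unmarried_add_two_le e hC hal
      (A := {p | ¬ Married (e.conf (e.roundEnd 0 (1 + k * (2 * G.maxDegree + 2)))) p})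
      (fun p hp => hp) (fun p _ q _ => or_comm.1 (em _)) hu hv huv heq.ge
    have h2 : {p | ¬ Married (e.conf (e.roundEnd 0 (1 + (k + 1) * (2 * G.maxDegree + 2)))) p} ⊆
        {p ∈ {p | ¬ Married (e.conf (e.roundEnd 0 (1 + k * (2 * G.maxDegree + 2)))) p} |
          ¬ Married (e.conf (e.roundEnd 0 (1 + (k + 1) * (2 * G.maxDegree + 2)))) p} := by
      intro p hp
      refine ⟨fun h => hp (married_of_le e hC ?_ hal h), hp⟩
      rw [heq]
      exact e.le_roundEnd _ _
    have h3 := Set.ncard_le_ncard h2 (Set.toFinite _)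
    omega

theorem exists_settled :
    ∃ i ≤ e.roundEnd 0 ((G.maxDegree + 1) * Fintype.card V + 2), Settled (e.conf i) := by
  have hal : ∀ k p, Aligned (e.conf (e.roundEnd 0 (1 + k))) p := fun k =>
    aligned_of_roundEnd_le e hC (e.roundEnd_mono 0 (Nat.le_add_right 1 k))
  have hbound : ∀ k l, k + l ≤ (G.maxDegree + 1) * Fintype.card V + 2 →
      e.roundEnd (e.roundEnd 0 k) l ≤ e.roundEnd 0 ((G.maxDegree + 1) * Fintype.card V + 2) := by
    intro k l h
    rw [← e.roundEnd_add]
    exact e.roundEnd_mono 0 h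
  set n := Fintype.card V
  have hn : 2 * (n / 2) ≤ n := Nat.mul_div_le n 2
  rcases maximal_or_ncard_le e hC (n / 2) with ⟨l, hl, h⟩ | h
  · refine ⟨_, hbound _ _ ?_, settled_of_maximal e hC (hal _) h⟩
    have : (G.maxDegree + 1) * (2 * (l + 1)) ≤ (G.maxDegree + 1) * n :=
      Nat.mul_le_mul_left _ (by omega)
    linarith
  rcases Nat.even_or_odd' n with ⟨m, hm | hm⟩
  · have hm' : n / 2 = m := by omega
    rw [hm'] at h
    refine ⟨_, hbound _ _ ?_, settled_of_married e hC (hal (m * (2 * G.maxDegree + 2)))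
      fun p => ?_⟩
    -- The bound is attained exactly: one round to align, `m` blocks, one round to settle.
    · rw [hm]
      linarith
    · have h0 := (Set.ncard_eq_zero (Set.toFinite _)).1 (Nat.le_zero.1 (by omega :
        {p | ¬ Married (e.conf (e.roundEnd 0 (1 + m * (2 * G.maxDegree + 2)))) p}.ncard ≤ 0))
      by_contra hp
      exact (Set.eq_empty_iff_forall_notMem.1 h0 p) hp
  -- For odd `n` at most one process remains unmarried. Two rounds are needed to settle, but the
  -- blocks account only for `n - 1` processes.
  · have hm' : n / 2 = m := by omega
    rw [hm'] at h
    refine ⟨_, hbound _ _ ?_, settled_of_maximal e hC (hal (m * (2 * G.maxDegree + 2)))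
      fun p q hpq => ?_⟩
    · rw [hm]
      linarith
    · by_contra! hcon
      exact hpq.ne ((Set.ncard_le_one (Set.toFinite _)).1 (by omega :
        {p | ¬ Married (e.conf (e.roundEnd 0 (1 + m * (2 * G.maxDegree + 2)))) p}.ncard ≤ 1)
          p hcon.1 q hcon.2)

/-- No first round is needed: the endpoints of an agreed edge are aligned by definition. -/
theorem agreedEdges_subset_succ (t : ℕ) :
    agreedEdges (e.conf t) ⊆ agreedEdges (e.conf (t + 1)) := by
  have key : ∀ {p q}, InMM (e.conf t) p q →
      ptr (e.conf (t + 1)) p = some q ∧ Aligned (e.conf (t + 1)) p := by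
    intro p q h
    obtain ⟨h1, rfl⟩ := (inMM_iff _ _ _).1 h
    have hal : Aligned (e.conf t) p := .inr h1.1
    exact ⟨ptr_succ e hC hal h1.1 (.inl h1.2), aligned_succ e hC hal⟩
  rintro _ ⟨p, q, hadj, rfl, h1, h2⟩
  obtain ⟨h3, h4⟩ := key h1
  obtain ⟨h5, h6⟩ := key h2
  exact ⟨p, q, hadj, rfl, (inMM_iff _ _ _).2 (h4.wed h3 h5), (inMM_iff _ _ _).2 (h6.wed h5 h3)⟩

/-- The synchronous computation activates `p` at once; if `p` is not aligned, action 1 changes its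
pointer, a communication variable. -/
theorem aligned_of_silent [Nonempty V] {γ : ∀ p, MState G p}
    (hγ : (matchingProtocol G C idx).Silent γ) (p : V) : Aligned γ p := by
  by_contra hal
  have hfix := hγ (synchronous (matchingProtocol G C idx) γ) rfl 1 p
  rcases move_of_mem_sel (synchronous (matchingProtocol G C idx) γ) hC (t := 0) (p := p)
    (Set.mem_univ p) with ⟨-, h, -⟩ | ⟨h, -, -, -, -⟩ | ⟨-, -, h, -, -, -⟩ |
    ⟨-, -, h, -, -, -, -⟩ | ⟨-, -, h, -, -, -, -, -⟩ | ⟨-, -, h, -, -, -, -⟩ | ⟨-, h, -, -⟩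
  · refine hal (.inr (Eq.trans ?_ h))
    exact congrArg (fun x : MComm G p => x.PR.map Subtype.val) hfix.symm
  · exact hal h
  · exact hal (.inl h)
  · exact hal (.inr h)
  · exact hal (.inl h)
  · exact hal (.inl h)
  · exact hal (.inr h)

/-- Being married depends on communication variables only, so `γ` has the marriages of the settled
configuration reached from it. -/
theorem isMaximalMatching_of_silent [Nonempty V] {γ : ∀ p, MState G p}
    (hγ : (matchingProtocol G C idx).Silent γ) : IsMaximalMatching G (agreedEdges γ) := by
  refine isMaximalMatching_agreedEdges (aligned_of_silent hC hγ) fun p q hpq => ?_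
  obtain ⟨i, -, hi⟩ := exists_settled (synchronous (matchingProtocol G C idx) γ) hC
  have hmar := married_congr (γ := γ) (hγ (synchronous (matchingProtocol G C idx) γ) rfl i)
  rw [← hmar p, ← hmar q]
  exact hi.married_or p q hpq

theorem matchingProtocol_stabilizes :
    (matchingProtocol G C idx).Stabilizes (fun γ => IsMaximalMatching G (agreedEdges γ)) := by
  refine ⟨fun _ _ _ => trivial, fun e h0 i => ?_, fun e _ => ?_⟩
  · induction i with
    | zero => exact h0
    | succ i ih =>
      -- Agreed edges only accumulate and always form a matching, so a maximal one stays fixed.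
      have heq := ih.eq_of_subset (isMatching_agreedEdges _) (agreedEdges_subset_succ e hC i)
      simp only [← heq]
      exact ih
  · obtain ⟨i, -, hi⟩ := exists_settled e hC
    exact ⟨i, isMaximalMatching_agreedEdges hi.aligned hi.married_or⟩

end Settled

/-! ### Components of unmarried processes -/

section Components

variable {V : Type u} {G : SimpleGraph V} {γ : ∀ p, MState G p} {A : Set V}

/-- An unmarried neighbour could be adjoined to `A` without losing connectedness, against
maximality. -/
theorem IsUnmarriedComponent.mem_or_married (hA : IsUnmarriedComponent γ A) {p q : V}
    (hp : p ∈ A) (hpq : G.Adj p q) : q ∈ A ∨ Married γ q := by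
  by_contra! h
  refine h.1 (hA.2 (y := insert q A) ⟨?_, ?_⟩ (Set.subset_insert q A) (Set.mem_insert q A))
  · rintro x (rfl | hx)
    · exact h.2
    · exact hA.1.1 x hx
  · rw [← Set.union_singleton]
    exact SimpleGraph.connected_induce_union hA.1.2.preconnected
      SimpleGraph.Preconnected.of_subsingleton hp (Set.mem_singleton q) hpq

theorem IsUnmarriedComponent.exists_adj [Finite V] (hA : IsUnmarriedComponent γ A)
    (h2 : 2 ≤ A.ncard) : ∃ u ∈ A, ∃ v ∈ A, G.Adj u v := by
  obtain ⟨a, ha, b, hb, hab⟩ := (Set.one_lt_ncard (Set.toFinite A)).1 h2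
  have : Nontrivial A := ⟨⟨a, ha⟩, ⟨b, hb⟩, by simpa using hab⟩
  obtain ⟨v, hv⟩ := hA.1.2.preconnected.exists_adj_of_nontrivial ⟨a, ha⟩
  exact ⟨a, ha, v, v.2, hv⟩

end Components

end SelfStab

theorem mainTheorem6 {V : Type*} [Fintype V] (G : SimpleGraph V) [DecidableRel G.Adj]
    (hG : G.Connected) {K : Type*} [LinearOrder K] (C : V → K)
    (hC : ∀ p q, G.Adj p q → C p ≠ C q)
    (idx : ∀ p, G.neighborSet p ≃ Fin (G.degree p)) :
    -- 1-efficiency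
    (SelfStab.matchingProtocol G C idx).KEfficient 1 ∧
    -- self-stabilization to a maximal matching
    (SelfStab.matchingProtocol G C idx).Stabilizes
      (fun γ => SelfStab.IsMaximalMatching G (SelfStab.agreedEdges γ)) ∧
    -- every silent configuration is a maximal matching, for both readings of the output
    (∀ γ, (SelfStab.matchingProtocol G C idx).Silent γ →
      SelfStab.IsMaximalMatching G (SelfStab.outputEdges γ) ∧
        SelfStab.outputEdges γ = SelfStab.agreedEdges γ) ∧
    -- a silent configuration is reached within `(Δ + 1) n + 2` rounds
    (∀ e : (SelfStab.matchingProtocol G C idx).Computation,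
      ∃ i ≤ e.roundEnd 0 ((G.maxDegree + 1) * Fintype.card V + 2),
        (SelfStab.matchingProtocol G C idx).Silent (e.conf i)) ∧
    -- after the first round, the edges claimed by one endpoint are those claimed by both
    (∀ e : (SelfStab.matchingProtocol G C idx).Computation, ∀ i, e.roundEnd 0 1 ≤ i →
      SelfStab.outputEdges (e.conf i) = SelfStab.agreedEdges (e.conf i)) ∧
    -- after the first round, unmarried components shrink by 2 within `2 Δ + 2` rounds
    (∀ e : (SelfStab.matchingProtocol G C idx).Computation, ∀ i, e.roundEnd 0 1 ≤ i →
      ∀ A : Set V, SelfStab.IsUnmarriedComponent (e.conf i) A → 2 ≤ A.ncard →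
        ∀ j, e.roundEnd i (2 * G.maxDegree + 2) ≤ j →
          {p ∈ A | ¬ SelfStab.Married (e.conf j) p}.ncard + 2 ≤ A.ncard) := by
  have := hG.nonempty
  refine ⟨SelfStab.matchingProtocol_kEfficient C idx, SelfStab.matchingProtocol_stabilizes hC,
    fun γ hγ => ?_, fun e => ?_, fun e i hi => ?_, fun e i hi A hA h2 j hj => ?_⟩
  · have heq := SelfStab.outputEdges_eq_agreedEdges (SelfStab.aligned_of_silent hC hγ)
    exact ⟨heq ▸ SelfStab.isMaximalMatching_of_silent hC hγ, heq⟩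
  · obtain ⟨i, hi, hs⟩ := SelfStab.exists_settled e hC
    exact ⟨i, hi, hs.silent hC⟩
  · exact SelfStab.outputEdges_eq_agreedEdges (SelfStab.aligned_of_roundEnd_le e hC hi)
  · obtain ⟨u, hu, v, hv, huv⟩ := hA.exists_adj h2
    exact SelfStab.ncard_unmarried_add_two_le e hC (SelfStab.aligned_of_roundEnd_le e hC hi)
      hA.1.1 (fun p hp q hpq => hA.mem_or_married hp hpq) hu hv huv hj
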